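/- Let $\Bbbk=\mathbb{R}$ or $\mathbb{C}$, with $\langle x,y\rangle=x^*y$ and $\lVert\cdot\rVert$ the Euclidean (Hermitian) inner product and norm on $\Bbbk^d$. For a Hermitian $A=(a_{ij})\in\Bbbk^{n\times n}$, and for $B=(b_{ij})\in\Bbbk^{m\times n}$, put \[ \lVert A\rVert_\gamma^\Bbbk=\max_{\lVert x_i\rVert=1}\Bigl|\sum_{i,j}a_{ij}\langle x_i,x_j\rangle\Bigr|,\quad \lVert A\rVert_\Gamma^\Bbbk=\max_{\lVert x_i\rVert\le1}\Bigl|\sum_{i,j}a_{ij}\langle x_i,x_j\rangle\Bigr|,\quad \lVert B\rVert_{\mathsf G}^\Bbbk=\max_{\lVert x_i\rVert\le1,\lVert y_j\rVert\le1}\Bigl|\sum_{i,j}b_{ij}\langle x_i,y_j\rangle\Bigr|, \] where the vectors range over $\Bbbk^d$ with $d\ge n$ in the first two maxima and $d\ge m+n$ in the third (the values do not depend on such $d$), and \[ \lVert A\rVert_\theta^\Bbbk=\max_{|\delta_i|=1}\Bigl|\sum_{i,j}a_{ij}\bar\delta_i\delta_j\Bigr|,\quad \lVert A\rVert_\Theta^\Bbbk=\max_{|\delta_i|\le1}\Bigl|\sum_{i,j}a_{ij}\bar\delta_i\delta_j\Bigr|,\quad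 \lVert B\rVert_{\infty,1}^\Bbbk=\max_{|\varepsilon_i|\le1,|\delta_j|\le1}\Bigl|\sum_{i,j}b_{ij}\bar\varepsilon_i\delta_j\Bigr|, \] where the scalars range over $\Bbbk$. Let \[ \varphi_{\mathbb R}(x)=\frac2\pi\arcsin x,\qquad \varphi_{\mathbb C}(z)=\frac\pi4\sum_{k=0}^\infty\Bigl(\frac{(2k-1)!!}{(2k)!!}\Bigr)^2\frac1{k+1}\,z|z|^{2k},\qquad \alpha_{\mathsf{GW}}^\Bbbk=\inf_{0\le x\le1}\frac{1+\varphi_\Bbbk(x)}{1+x}, \] and $a_0^{\mathbb R}=2/\pi$, $a_0^{\mathbb C}=\pi/4$. Then for every $n$ and every real symmetric matrix $A\in\mathbb{R}^{n\times n}$ that is diagonally dominant, i.e. $a_{ii}\ge\sum_{j\ne i}|a_{ij}|$ for all $i$, and for both $\Bbbk=\mathbb{R}$ and $\Bbbk=\mathbb{C}$, \[ \lVert A\rVert_\gamma^\Bbbk\le\Bigl(1+\frac{1-a_0^\Bbbk}{\alpha_{\mathsf{GW}}^\Bbbk}\Bigr)\lVert A\rVert_\theta^\Bbbk . \] In this inequality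 $\lVert\cdot\rVert_\gamma^\Bbbk$ may be replaced by $\lVert\cdot\rVert_\Gamma^\Bbbk$ or $\lVert\cdot\rVert_{\mathsf G}^\Bbbk$, and $\lVert\cdot\rVert_\theta^\Bbbk$ may be replaced, independently, by $\lVert\cdot\rVert_\Theta^\Bbbk$ or $\lVert\cdot\rVert_{\infty,1}^\Bbbk$. -/

import Mathlib

namespace Groth

section Norms

variable {𝕜 : Type*} [RCLike 𝕜] {m n : ℕ}

/-- The `(γ, d)`-seminorm: the maximum of `|∑ᵢ ∑ⱼ aᵢⱼ ⟨xᵢ, xⱼ⟩|` over unit vectors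
`x₁, …, xₙ ∈ 𝕜ᵈ`. (`inner` is conjugate-linear in its first argument, so `⟨x, y⟩ = x* y`.) -/
noncomputable def gammaSeminorm (d : ℕ) (A : Matrix (Fin n) (Fin n) 𝕜) : ℝ :=
  sSup {r : ℝ | ∃ x : Fin n → EuclideanSpace 𝕜 (Fin d), (∀ i, ‖x i‖ = 1) ∧
    r = ‖∑ i, ∑ j, A i j * inner 𝕜 (x i) (x j)‖}

/-- The `(Γ, d)`-norm: as the `(γ, d)`-seminorm, but over vectors of norm at most one. -/
noncomputable def capGammaNorm (d : ℕ) (A : Matrix (Fin n) (Fin n) 𝕜) : ℝ :=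
  sSup {r : ℝ | ∃ x : Fin n → EuclideanSpace 𝕜 (Fin d), (∀ i, ‖x i‖ ≤ 1) ∧
    r = ‖∑ i, ∑ j, A i j * inner 𝕜 (x i) (x j)‖}

/-- The `(G, d)`-norm of a rectangular matrix: the maximum of `|∑ᵢ ∑ⱼ bᵢⱼ ⟨xᵢ, yⱼ⟩|` over
vectors `xᵢ, yⱼ ∈ 𝕜ᵈ` of norm at most one. -/
noncomputable def gNorm (d : ℕ) (B : Matrix (Fin m) (Fin n) 𝕜) : ℝ :=
  sSup {r : ℝ | ∃ (x : Fin m → EuclideanSpace 𝕜 (Fin d)) (y : Fin n → EuclideanSpace 𝕜 (Fin d)),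
    (∀ i, ‖x i‖ ≤ 1) ∧ (∀ j, ‖y j‖ ≤ 1) ∧
    r = ‖∑ i, ∑ j, B i j * inner 𝕜 (x i) (y j)‖}

/-- The `θ`-seminorm: the maximum of `|∑ᵢ ∑ⱼ aᵢⱼ δ̄ᵢ δⱼ|` over scalars `δᵢ ∈ 𝕜`, `|δᵢ| = 1`. -/
noncomputable def thetaSeminorm (A : Matrix (Fin n) (Fin n) 𝕜) : ℝ :=
  sSup {r : ℝ | ∃ δ : Fin n → 𝕜, (∀ i, ‖δ i‖ = 1) ∧
    r = ‖∑ i, ∑ j, A i j * (star (δ i) * δ j)‖}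

/-- The `Θ`-norm: as the `θ`-seminorm, but over scalars of absolute value at most one. -/
noncomputable def capThetaNorm (A : Matrix (Fin n) (Fin n) 𝕜) : ℝ :=
  sSup {r : ℝ | ∃ δ : Fin n → 𝕜, (∀ i, ‖δ i‖ ≤ 1) ∧
    r = ‖∑ i, ∑ j, A i j * (star (δ i) * δ j)‖}

/-- The `(∞, 1)`-norm of a rectangular matrix: the maximum of `|∑ᵢ ∑ⱼ bᵢⱼ ε̄ᵢ δⱼ|` over scalars
of absolute value at most one. -/
noncomputable def inftyOneNorm (B : Matrix (Fin m) (Fin n) 𝕜) : ℝ :=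
  sSup {r : ℝ | ∃ (ε : Fin m → 𝕜) (δ : Fin n → 𝕜), (∀ i, ‖ε i‖ ≤ 1) ∧ (∀ j, ‖δ j‖ ≤ 1) ∧
    r = ‖∑ i, ∑ j, B i j * (star (ε i) * δ j)‖}

/-! The suprema above are attained maxima. -/

theorem isGreatest_sSup_of_compact {X : Type*} [TopologicalSpace X] {K : Set X}
    (hK : IsCompact K) (hne : K.Nonempty) {f : X → ℝ} (hf : Continuous f) {S : Set ℝ}
    (hS : S = f '' K) : IsGreatest S (sSup S) := by
  subst hS
  exact (hK.image hf).isGreatest_sSup (hne.image f)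

theorem compact_le {ι E : Type*} [SeminormedAddCommGroup E] [ProperSpace E] :
    IsCompact {x : ι → E | ∀ i, ‖x i‖ ≤ 1} := by
  have : {x : ι → E | ∀ i, ‖x i‖ ≤ 1} = Set.univ.pi fun _ => Metric.closedBall (0 : E) 1 := by
    ext x; simp
  rw [this]
  exact isCompact_univ_pi fun _ => isCompact_closedBall _ _

theorem compact_eq {ι E : Type*} [SeminormedAddCommGroup E] [ProperSpace E] :
    IsCompact {x : ι → E | ∀ i, ‖x i‖ = 1} := by
  have : {x : ι → E | ∀ i, ‖x i‖ = 1} = Set.univ.pi fun _ => Metric.sphere (0 : E) 1 := by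
    ext x; simp
  rw [this]
  exact isCompact_univ_pi fun _ => isCompact_sphere _ _

theorem gammaSeminorm_isGreatest {d : ℕ} (hd : n ≤ d) (A : Matrix (Fin n) (Fin n) 𝕜) :
    IsGreatest {r : ℝ | ∃ x : Fin n → EuclideanSpace 𝕜 (Fin d), (∀ i, ‖x i‖ = 1) ∧
      r = ‖∑ i, ∑ j, A i j * inner 𝕜 (x i) (x j)‖} (gammaSeminorm d A) := by
  refine isGreatest_sSup_of_compact (K := {x : Fin n → EuclideanSpace 𝕜 (Fin d) | ∀ i, ‖x i‖ = 1})
    (f := fun x => ‖∑ i, ∑ j, A i j * inner 𝕜 (x i) (x j)‖) compact_eq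
    ⟨fun i => EuclideanSpace.single (Fin.castLE hd i) 1, fun i => by simp⟩ (by fun_prop) ?_
  ext r; simp [eq_comm]

theorem capGammaNorm_isGreatest (d : ℕ) (A : Matrix (Fin n) (Fin n) 𝕜) :
    IsGreatest {r : ℝ | ∃ x : Fin n → EuclideanSpace 𝕜 (Fin d), (∀ i, ‖x i‖ ≤ 1) ∧
      r = ‖∑ i, ∑ j, A i j * inner 𝕜 (x i) (x j)‖} (capGammaNorm d A) := by
  refine isGreatest_sSup_of_compact (K := {x : Fin n → EuclideanSpace 𝕜 (Fin d) | ∀ i, ‖x i‖ ≤ 1})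
    (f := fun x => ‖∑ i, ∑ j, A i j * inner 𝕜 (x i) (x j)‖) compact_le
    ⟨0, fun i => by simp⟩ (by fun_prop) ?_
  ext r; simp [eq_comm]

theorem gNorm_isGreatest (d : ℕ) (B : Matrix (Fin m) (Fin n) 𝕜) :
    IsGreatest {r : ℝ | ∃ (x : Fin m → EuclideanSpace 𝕜 (Fin d))
      (y : Fin n → EuclideanSpace 𝕜 (Fin d)), (∀ i, ‖x i‖ ≤ 1) ∧ (∀ j, ‖y j‖ ≤ 1) ∧
      r = ‖∑ i, ∑ j, B i j * inner 𝕜 (x i) (y j)‖} (gNorm d B) := by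
  refine isGreatest_sSup_of_compact
    (K := {x : Fin m → EuclideanSpace 𝕜 (Fin d) | ∀ i, ‖x i‖ ≤ 1} ×ˢ
      {y : Fin n → EuclideanSpace 𝕜 (Fin d) | ∀ i, ‖y i‖ ≤ 1})
    (f := fun p => ‖∑ i, ∑ j, B i j * inner 𝕜 (p.1 i) (p.2 j)‖) (compact_le.prod compact_le)
    ⟨0, by simp⟩ (by fun_prop) ?_
  ext r; simp [eq_comm, and_assoc]

theorem thetaSeminorm_isGreatest (A : Matrix (Fin n) (Fin n) 𝕜) :
    IsGreatest {r : ℝ | ∃ δ : Fin n → 𝕜, (∀ i, ‖δ i‖ = 1) ∧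
      r = ‖∑ i, ∑ j, A i j * (star (δ i) * δ j)‖} (thetaSeminorm A) := by
  refine isGreatest_sSup_of_compact (K := {x : Fin n → 𝕜 | ∀ i, ‖x i‖ = 1})
    (f := fun δ => ‖∑ i, ∑ j, A i j * (star (δ i) * δ j)‖) compact_eq
    ⟨1, fun i => by simp⟩ (by fun_prop) ?_
  ext r; simp [eq_comm]

theorem capThetaNorm_isGreatest (A : Matrix (Fin n) (Fin n) 𝕜) :
    IsGreatest {r : ℝ | ∃ δ : Fin n → 𝕜, (∀ i, ‖δ i‖ ≤ 1) ∧
      r = ‖∑ i, ∑ j, A i j * (star (δ i) * δ j)‖} (capThetaNorm A) := by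
  refine isGreatest_sSup_of_compact (K := {x : Fin n → 𝕜 | ∀ i, ‖x i‖ ≤ 1})
    (f := fun δ => ‖∑ i, ∑ j, A i j * (star (δ i) * δ j)‖) compact_le
    ⟨1, fun i => by simp⟩ (by fun_prop) ?_
  ext r; simp [eq_comm]

theorem inftyOneNorm_isGreatest (B : Matrix (Fin m) (Fin n) 𝕜) :
    IsGreatest {r : ℝ | ∃ (ε : Fin m → 𝕜) (δ : Fin n → 𝕜), (∀ i, ‖ε i‖ ≤ 1) ∧
      (∀ j, ‖δ j‖ ≤ 1) ∧ r = ‖∑ i, ∑ j, B i j * (star (ε i) * δ j)‖} (inftyOneNorm B) := by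
  refine isGreatest_sSup_of_compact
    (K := {x : Fin m → 𝕜 | ∀ i, ‖x i‖ ≤ 1} ×ˢ {y : Fin n → 𝕜 | ∀ i, ‖y i‖ ≤ 1})
    (f := fun p => ‖∑ i, ∑ j, B i j * (star (p.1 i) * p.2 j)‖) (compact_le.prod compact_le)
    ⟨0, by simp⟩ (by fun_prop) ?_
  ext r; simp [eq_comm, and_assoc]

end Norms

section Constants

/-- `φ_ℝ(x) = (2/π) arcsin x`, used for `x ∈ [-1, 1]`. -/
noncomputable def phiReal (x : ℝ) : ℝ := 2 / Real.pi * Real.arcsin x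

/-- The coefficient `((2k-1)!!/(2k)!!)² / (k+1)`; for `k = 0` it is `1`, as
`(-1)!! = 0!! = 1` (the truncated `2 * 0 - 1 = 0` gives the right value). -/
noncomputable def phiCoeff (k : ℕ) : ℝ :=
  ((Nat.doubleFactorial (2 * k - 1) : ℝ) / (Nat.doubleFactorial (2 * k) : ℝ)) ^ 2 * (1 / ((k : ℝ) + 1))

/-- `φ_ℂ(z) = (π/4) ∑ₖ ((2k-1)!!/(2k)!!)² (1/(k+1)) z |z|²ᵏ`, used for `|z| ≤ 1`. -/
noncomputable def phiComplex (z : ℂ) : ℂ :=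
  (Real.pi : ℂ) / 4 * ∑' k : ℕ, (phiCoeff k : ℂ) * (z * (‖z‖ : ℂ) ^ (2 * k))

theorem phiCoeff_nonneg (k : ℕ) : 0 ≤ phiCoeff k := by
  unfold phiCoeff; positivity

theorem doubleFactorial_ratio_sq_le (k : ℕ) :
    ((Nat.doubleFactorial (2 * k - 1) : ℝ) / (Nat.doubleFactorial (2 * k) : ℝ)) ^ 2
      ≤ 1 / ((k : ℝ) + 1) := by
  induction k with
  | zero => simp
  | succ k ih =>
    have h1 : (Nat.doubleFactorial (2 * (k + 1) - 1) : ℝ)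
        = (2 * k + 1) * Nat.doubleFactorial (2 * k - 1) := by
      rcases k with _ | k
      · simp
      · have : 2 * (k + 1 + 1) - 1 = (2 * (k + 1) - 1) + 2 := by omega
        rw [this, Nat.doubleFactorial_add_two]
        push_cast [show 2 * (k + 1) - 1 = 2 * k + 1 by omega]
        ring
    have h2 : (Nat.doubleFactorial (2 * (k + 1)) : ℝ)
        = (2 * k + 2) * Nat.doubleFactorial (2 * k) := by
      rw [show 2 * (k + 1) = 2 * k + 2 by ring, Nat.doubleFactorial_add_two]
      push_cast; ring
    rw [h1, h2, mul_div_mul_comm, mul_pow]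
    refine (mul_le_mul_of_nonneg_left ih (by positivity)).trans ?_
    rw [div_pow, div_mul_div_comm, div_le_div_iff₀ (by positivity) (by positivity)]
    push_cast
    have : (0 : ℝ) ≤ k := Nat.cast_nonneg k
    nlinarith [sq_nonneg (k : ℝ), pow_nonneg this 3]

/-- The series defining `φ_ℂ` converges absolutely on the closed unit disk. -/
theorem phiComplex_summable {z : ℂ} (hz : ‖z‖ ≤ 1) :
    Summable fun k : ℕ => (phiCoeff k : ℂ) * (z * (‖z‖ : ℂ) ^ (2 * k)) := by
  have hs : Summable fun k : ℕ => 1 / ((k : ℝ) + 1) ^ 2 := by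
    have := (summable_nat_add_iff 1).2 (Real.summable_one_div_nat_pow.2 one_lt_two)
    simpa using this
  refine Summable.of_norm_bounded hs fun k => ?_
  rw [norm_mul, norm_mul, norm_pow, Complex.norm_real, Complex.norm_real, norm_norm,
    Real.norm_of_nonneg (phiCoeff_nonneg k)]
  have h1 : phiCoeff k ≤ 1 / ((k : ℝ) + 1) ^ 2 := by
    have := mul_le_mul_of_nonneg_right (doubleFactorial_ratio_sq_le k)
      (show (0 : ℝ) ≤ 1 / ((k : ℝ) + 1) by positivity)
    refine this.trans (le_of_eq ?_)
    field_simp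
  have h2 : ‖z‖ * ‖z‖ ^ (2 * k) ≤ 1 :=
    mul_le_one₀ hz (by positivity) (pow_le_one₀ (norm_nonneg z) hz)
  calc phiCoeff k * (‖z‖ * ‖z‖ ^ (2 * k)) ≤ phiCoeff k * 1 :=
        mul_le_mul_of_nonneg_left h2 (phiCoeff_nonneg k)
    _ ≤ _ := by rwa [mul_one]

/-- `α_GW` over `ℝ`: the infimum of `(1 + φ_ℝ(x)) / (1 + x)` over `0 ≤ x ≤ 1`. -/
noncomputable def alphaReal : ℝ :=
  sInf ((fun x : ℝ => (1 + phiReal x) / (1 + x)) '' Set.Icc 0 1)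

/-- `α_GW` over `ℂ`: the infimum of `(1 + φ_ℂ(x)) / (1 + x)` over real `0 ≤ x ≤ 1`; at such `x`
the value `φ_ℂ(x)` is real, and it is read as a real number by taking its real part. -/
noncomputable def alphaComplex : ℝ :=
  sInf ((fun x : ℝ => (1 + (phiComplex (x : ℂ)).re) / (1 + x)) '' Set.Icc 0 1)

end Constants

/-- Real symmetric diagonally dominant matrices: `aᵢᵢ ≥ ∑_{j ≠ i} |aᵢⱼ|` for every `i`. -/
def IsSymmDiagDominant {n : ℕ} (A : Matrix (Fin n) (Fin n) ℝ) : Prop :=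
  A.IsSymm ∧ ∀ i, ∑ j ∈ Finset.univ.erase i, |A i j| ≤ A i i

end Groth

/-! Everything is reduced to one real inequality with the constant `40/33`. The stated constants are
at least that large, because each α is at most 1 and both values of a₀ are below `63/80`.

For unit vectors, rounding xᵢ to the sign of ⟨xᵢ, g⟩, with g uniform in the unit ball, gives signs
whose expected products are φ(⟨xᵢ, xⱼ⟩), where φ = (2/π) arcsin. Hence the form of A at φ(⟨xᵢ, xⱼ⟩)
is at most the real θ-seminorm (`sum_arcsin_le_thetaSeminorm`). With c = 33/40, |φ(t) - ct| ≤ 1 - c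
on [-1, 1], with the value 1 - c at t = 1. So diagonal dominance makes the form of A nonnegative at
φ(⟨xᵢ, xⱼ⟩) - c⟨xᵢ, xⱼ⟩ (`sum_mul_nonneg_of_diagDominant`), and c∑aᵢⱼ⟨xᵢ, xⱼ⟩ ≤ ‖A‖_θ follows.

Shorter vectors are completed to unit ones, and two families are handled by positive
semidefiniteness. Complex vectors are treated as real ones through the real part of the inner
product. The real θ-seminorm is the smallest of all the right-hand norms, so one bound serves every
combination. -/

namespace Groth

/-! ### Random hyperplane rounding and the arcsine law -/

section Separation

open MeasureTheory Metric

variable {E : Type*} [NormedAddCommGroup E] [InnerProductSpace ℝ E]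

/-- The points of the unit ball at which the linear forms `⟨x, ·⟩` and `⟨y, ·⟩` have
different signs. -/
def separated (x y : E) : Set E :=
  {g | g ∈ ball (0 : E) 1 ∧ ¬ (0 ≤ inner ℝ x g ↔ 0 ≤ inner ℝ y g)}

/-- The sign of `⟨x, g⟩`, with the convention that it is `1` where this vanishes. -/
noncomputable def signForm (x g : E) : ℝ := open Classical in if 0 ≤ inner ℝ x g then 1 else -1

theorem signForm_mul_eq {x y g : E} (hg : g ∈ ball (0 : E) 1) :
    signForm x g * signForm y g = 1 - 2 * (separated x y).indicator (fun _ => (1 : ℝ)) g := by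
  classical
  by_cases h1 : 0 ≤ inner ℝ x g <;> by_cases h2 : 0 ≤ inner ℝ y g <;>
    simp [signForm, separated, Set.indicator, h1, h2, mem_ball_zero_iff.1 hg] <;> norm_num

variable [MeasurableSpace E] [BorelSpace E]

theorem measurableSet_separated (x y : E) : MeasurableSet (separated x y) := by
  have h (z : E) : MeasurableSet {g : E | 0 ≤ inner ℝ z g} :=
    measurableSet_le measurable_const (by fun_prop)
  have h3 : separated x y = ball (0 : E) 1 ∩
      (({g : E | 0 ≤ inner ℝ x g} \ {g : E | 0 ≤ inner ℝ y g}) ∪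
        ({g : E | 0 ≤ inner ℝ y g} \ {g : E | 0 ≤ inner ℝ x g})) := by
    ext g
    simp only [separated, Set.mem_ofPred_eq, Set.mem_inter_iff, Set.mem_union, Set.mem_sdiff]
    tauto
  rw [h3]
  exact measurableSet_ball.inter (((h x).diff (h y)).union ((h y).diff (h x)))

variable [FiniteDimensional ℝ E]

/-- The volume of the part of the unit ball on which `⟨x, ·⟩` and `⟨y, ·⟩` have different signs. -/
noncomputable def sepVol (x y : E) : ℝ := volume.real (separated x y)

theorem separated_volume_ne_top (x y : E) : volume (separated x y) ≠ ⊤ :=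
  ((measure_mono fun _ hg => hg.1).trans_lt (measure_ball_lt_top (x := (0 : E)) (r := 1))).ne

theorem sepVol_comm (x y : E) : sepVol x y = sepVol y x := by
  have : separated x y = separated y x := by
    ext g; simp only [separated, Set.mem_ofPred_eq]; tauto
  rw [sepVol, sepVol, this]

theorem sepVol_self (x : E) : sepVol x x = 0 := by
  have : separated x x = ∅ := by ext g; simp [separated]
  rw [sepVol, this]; simp

theorem sepVol_map (R : E ≃ₗᵢ[ℝ] E) (x y : E) : sepVol (R x) (R y) = sepVol x y := by
  have h := R.measurePreserving.measure_preimage (measurableSet_separated (R x) (R y)).nullMeasurableSet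
  have h2 : R ⁻¹' separated (R x) (R y) = separated x y := by
    ext g; simp [separated, LinearIsometryEquiv.inner_map_map]
  rw [sepVol, sepVol, Measure.real, Measure.real, ← h, h2]

/-- The volume `sepVol x y` of unit vectors depends on their inner product only. -/
theorem sepVol_congr {x y x' y' : E} (hx : ‖x‖ = 1) (hy : ‖y‖ = 1) (hx' : ‖x'‖ = 1)
    (hy' : ‖y'‖ = 1) (h : inner ℝ x y = inner ℝ x' y') : sepVol x y = sepVol x' y' := by
  -- Two reflections carry one pair to the other: the first sends x to x', the second sends the
  -- image of y to y'. Equality of inner products puts x' in the mirror of the second, so x' stays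
  -- fixed.
  set R := (ℝ ∙ (x - x'))ᗮ.reflection with hR
  have hRx : R x = x' := Submodule.reflection_sub (hx.trans hx'.symm)
  set z := R y with hz
  have hzn : ‖z‖ = 1 := by rw [hz, LinearIsometryEquiv.norm_map, hy]
  have hxz : inner ℝ x' z = inner ℝ x y := by
    rw [← hRx, hz, LinearIsometryEquiv.inner_map_map]
  set S := (ℝ ∙ (z - y'))ᗮ.reflection with hS
  have hSz : S z = y' := Submodule.reflection_sub (hzn.trans hy'.symm)
  have hSx : S x' = x' := by
    apply Submodule.reflection_mem_subspace_eq_self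
    rw [Submodule.mem_orthogonal_singleton_iff_inner_left, inner_sub_right, hxz, h, sub_self]
  rw [← sepVol_map R x y, hRx, ← hz, ← sepVol_map S x' z, hSx, hSz]

/-- Where x and z agree in sign, y in their cone has the same sign. Hence a sign change from x to z
occurs in exactly one of the steps x to y and y to z. -/
theorem sepVol_add_of_mem_cone {x y z : E} {a b : ℝ} (ha : 0 ≤ a) (hb : 0 ≤ b) (hab : 0 < a + b)
    (hy : y = a • x + b • z) : sepVol x z = sepVol x y + sepVol y z := by
  have hin (g : E) : inner ℝ y g = a * inner ℝ x g + b * inner ℝ z g := by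
    rw [hy, inner_add_left, real_inner_smul_left, real_inner_smul_left]
  have hp (g : E) (h1 : 0 ≤ inner ℝ x g) (h2 : 0 ≤ inner ℝ z g) : 0 ≤ inner ℝ y g := by
    rw [hin]; positivity
  have hn (g : E) (h1 : ¬ 0 ≤ inner ℝ x g) (h2 : ¬ 0 ≤ inner ℝ z g) : ¬ 0 ≤ inner ℝ y g := by
    rw [hin]; push Not at *
    rcases ha.eq_or_lt with rfl | ha
    · have : 0 < b := by linarith
      nlinarith [mul_pos this (neg_pos.2 h2)]
    · nlinarith [mul_pos ha (neg_pos.2 h1), mul_nonneg hb (neg_pos.2 h2).le]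
  have hU : separated x z = separated x y ∪ separated y z := by
    ext g
    have := hp g; have := hn g
    simp only [separated, Set.mem_ofPred_eq, Set.mem_union]; tauto
  have hd : Disjoint (separated x y) (separated y z) := by
    rw [Set.disjoint_left]
    intro g
    have := hp g; have := hn g
    simp only [separated, Set.mem_ofPred_eq]; tauto
  rw [sepVol, hU, measureReal_union hd (measurableSet_separated _ _)
    (separated_volume_ne_top _ _) (separated_volume_ne_top _ _)]
  rfl

/-- Off the null hyperplane orthogonal to y, the forms of y and -y have opposite signs, so exactly
one of them disagrees with x. -/
theorem sepVol_add_sepVol_neg (x : E) {y : E} (hy : y ≠ 0) :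
    sepVol x y + sepVol x (-y) = volume.real (ball (0 : E) 1) := by
  have hnull : volume {g : E | inner ℝ y g = 0} = 0 := by
    have h1 : {g : E | inner ℝ y g = 0} = ((ℝ ∙ y)ᗮ : Submodule ℝ E) := by
      ext g; simp [Submodule.mem_orthogonal_singleton_iff_inner_right]
    rw [h1]
    apply Measure.addHaar_submodule
    intro h
    have : y ∈ (ℝ ∙ y)ᗮ := by rw [h]; trivial
    rw [Submodule.mem_orthogonal_singleton_iff_inner_right, inner_self_eq_zero] at this
    exact hy this
  have hae : (separated x (-y) : Set E) =ᵐ[volume] (ball (0 : E) 1 \ separated x y : Set E) := by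
    have h0 : ∀ᵐ g : E, inner ℝ y g ≠ 0 := by
      rw [ae_iff]; simpa using hnull
    rw [Filter.eventuallyEq_set]
    filter_upwards [h0] with g hg
    have h2 : 0 ≤ inner ℝ (-y) g ↔ ¬ 0 ≤ inner ℝ y g := by
      rw [inner_neg_left, not_le, Left.nonneg_neg_iff]
      exact ⟨fun h => lt_of_le_of_ne h hg, le_of_lt⟩
    simp only [separated, Set.mem_ofPred_eq, Set.mem_sdiff, h2]
    tauto
  have hsub : separated x y ⊆ ball (0 : E) 1 := fun _ hg => hg.1
  rw [sepVol, sepVol, measureReal_congr hae,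
    measureReal_sdiff hsub (measurableSet_separated _ _)]
  · ring

/-- A function on `[0, 1]` that is nonnegative and additive is linear. -/
theorem eq_mul_of_additive_of_nonneg {f : ℝ → ℝ} (h0 : ∀ t, 0 ≤ t → t ≤ 1 → 0 ≤ f t)
    (hadd : ∀ s t, 0 ≤ s → 0 ≤ t → s + t ≤ 1 → f (s + t) = f s + f t) {t : ℝ}
    (ht0 : 0 ≤ t) (ht1 : t ≤ 1) : f t = t * f 1 := by
  have hz : f 0 = 0 := by
    have := hadd 0 0 le_rfl le_rfl (by norm_num)
    rw [add_zero] at this; linarith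
  have hmul (β : ℝ) (hβ : 0 ≤ β) (m : ℕ) : m * β ≤ 1 → f (m * β) = m * f β := by
    induction m with
    | zero => intro _; simp [hz]
    | succ m ih =>
      intro h
      push_cast at h ⊢
      rw [add_mul, one_mul] at h ⊢
      rw [hadd _ _ (by positivity) hβ h, ih (by linarith)]; ring
  -- Nonnegativity makes f monotone. Rounding t down to a multiple of 1/M costs at most f(1)/M,
  -- which tends to 0.
  have low (t : ℝ) (ht0 : 0 ≤ t) (ht1 : t ≤ 1) : t * f 1 ≤ f t := by
    have h1 := h0 1 zero_le_one le_rfl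
    have key (N : ℕ) : t * f 1 ≤ f t + f 1 * (1 / ((N : ℝ) + 1)) := by
      set M : ℝ := (N : ℝ) + 1 with hM
      have hMp : 0 < M := by positivity
      have hf1 : f 1 = M * f (1 / M) := by
        have := hmul (1 / M) (by positivity) (N + 1)
        push_cast at this
        rw [← hM, mul_one_div_cancel hMp.ne'] at this
        exact this le_rfl
      set m := ⌊M * t⌋₊ with hm
      have hm1 : (m : ℝ) ≤ M * t := Nat.floor_le (by positivity)
      have hm2 : M * t < m + 1 := Nat.lt_floor_add_one _
      have hmt : m * (1 / M) ≤ t := by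
        rw [mul_one_div, div_le_iff₀ hMp]; linarith
      have hfm := hmul (1 / M) (by positivity) m (hmt.trans ht1)
      have hmono := hadd (m * (1 / M)) (t - m * (1 / M)) (by positivity) (by linarith) (by linarith)
      rw [add_sub_cancel] at hmono
      have hnn := h0 (t - m * (1 / M)) (by linarith) (by
        have : (0 : ℝ) ≤ m * (1 / M) := by positivity
        linarith)
      have hq : f (1 / M) = f 1 / M := by rw [hf1]; field_simp
      have : f 1 * t ≤ (m + 1) * (f 1 / M) := by
        rw [mul_div_assoc', le_div_iff₀ hMp]
        nlinarith
      rw [hmono, hfm, hq]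
      calc t * f 1 = f 1 * t := mul_comm _ _
        _ ≤ (m + 1) * (f 1 / M) := this
        _ = m * (f 1 / M) + f 1 * (1 / M) := by ring
        _ ≤ _ := by linarith
    have hlim : Filter.Tendsto (fun N : ℕ => f t + f 1 * (1 / ((N : ℝ) + 1))) Filter.atTop
        (nhds (f t + f 1 * 0)) :=
      (tendsto_one_div_add_atTop_nhds_zero_nat.const_mul _).const_add _
    rw [mul_zero, add_zero] at hlim
    exact ge_of_tendsto' hlim key
  -- The lower bound at 1 - t is the upper bound at t.
  have h2 := low (1 - t) (by linarith) (by linarith)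
  have h3 := hadd t (1 - t) ht0 (by linarith) (by linarith)
  rw [add_sub_cancel] at h3
  have := low t ht0 ht1
  linarith

/-- By rotation invariance both vectors may be placed on the circle spanned by u and w. There the
separated volume is additive in the angle, hence linear, and at angle π it is the whole ball. -/
theorem sepVol_eq_arccos {u w x y : E} (hu : ‖u‖ = 1) (hw : ‖w‖ = 1) (huw : inner ℝ u w = 0)
    (hx : ‖x‖ = 1) (hy : ‖y‖ = 1) :
    sepVol x y = Real.arccos (inner ℝ x y) / Real.pi * volume.real (ball (0 : E) 1) := by
  have hpi := Real.pi_pos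
  set c : ℝ → E := fun θ => Real.cos θ • u + Real.sin θ • w with hc
  have hwu : inner ℝ w u = 0 := by rw [real_inner_comm, huw]
  have hinner (α β : ℝ) : inner ℝ (c α) (c β) = Real.cos (β - α) := by
    simp only [hc, inner_add_left, inner_add_right, real_inner_smul_left, real_inner_smul_right,
      huw, hwu, real_inner_self_eq_norm_sq, hu, hw, Real.cos_sub]
    ring
  have hnorm (α : ℝ) : ‖c α‖ = 1 := by
    have := hinner α α
    rw [real_inner_self_eq_norm_sq, sub_self, Real.cos_zero] at this
    exact (pow_eq_one_iff_of_nonneg (norm_nonneg _) two_ne_zero).1 this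
  have hne (α : ℝ) : c α ≠ 0 := by
    intro h; have := hnorm α; rw [h, norm_zero] at this; exact zero_ne_one this
  have hshift (α β : ℝ) : sepVol (c α) (c (α + β)) = sepVol (c 0) (c β) :=
    sepVol_congr (hnorm _) (hnorm _) (hnorm _) (hnorm _) (by rw [hinner, hinner]; congr 1; ring)
  have hcpi : c Real.pi = -c 0 := by simp [hc]
  have hfull : sepVol (c 0) (c Real.pi) = volume.real (ball (0 : E) 1) := by
    have := sepVol_add_sepVol_neg (c 0) (hne 0)
    rw [sepVol_self, zero_add] at this
    rw [hcpi, this]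
  have hadd (α β : ℝ) (hα : 0 ≤ α) (hβ : 0 ≤ β) (hs : α + β ≤ Real.pi) :
      sepVol (c 0) (c (α + β)) = sepVol (c 0) (c α) + sepVol (c 0) (c β) := by
    rw [← hshift α β]
    rcases hs.eq_or_lt with hs | hs
    -- For total angle π the endpoints are antipodal and span no planar cone, so the complement
    -- identity replaces cone additivity.
    · rw [hs, hfull, hcpi, sepVol_comm (c 0) (c α), sepVol_add_sepVol_neg _ (hne 0)]
    · rcases (add_nonneg hα hβ).eq_or_lt with h0 | h0
      · have ha : α = 0 := by linarith
        have hb : β = 0 := by linarith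
        simp [ha, hb, sepVol_self]
      · have hsin : 0 < Real.sin (α + β) := Real.sin_pos_of_pos_of_lt_pi h0 hs
        have e1 : c α = (Real.sin β / Real.sin (α + β)) • c 0 +
            (Real.sin α / Real.sin (α + β)) • c (α + β) := by
          have h1 : Real.sin β / Real.sin (α + β) +
              Real.sin α / Real.sin (α + β) * Real.cos (α + β) = Real.cos α := by
            field_simp
            have := Real.sin_sub (α + β) α
            rw [add_sub_cancel_left] at this
            linarith
          have h2 : Real.sin α / Real.sin (α + β) * Real.sin (α + β) = Real.sin α := by
            field_simp
          simp only [hc, Real.cos_zero, Real.sin_zero, one_smul, zero_smul, add_zero, smul_add,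
            smul_smul, h2]
          rw [← h1, add_smul, add_assoc]
        have hsa : 0 ≤ Real.sin α := Real.sin_nonneg_of_nonneg_of_le_pi hα (by linarith)
        have hsb : 0 ≤ Real.sin β := Real.sin_nonneg_of_nonneg_of_le_pi hβ (by linarith)
        refine sepVol_add_of_mem_cone (by positivity) (by positivity) ?_ e1
        rw [← add_div]
        refine div_pos ?_ hsin
        rcases hα.eq_or_lt with h | h
        · have : 0 < Real.sin β := Real.sin_pos_of_pos_of_lt_pi (by linarith) (by linarith)
          linarith
        · have : 0 < Real.sin α := Real.sin_pos_of_pos_of_lt_pi h (by linarith)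
          linarith
  set θ := Real.arccos (inner ℝ x y) with hθ
  have hb := abs_le.1 ((abs_real_inner_le_norm x y).trans_eq (by rw [hx, hy, one_mul]))
  have hxy : sepVol x y = sepVol (c 0) (c θ) :=
    sepVol_congr hx hy (hnorm _) (hnorm _)
      (by rw [hinner, sub_zero, hθ, Real.cos_arccos hb.1 hb.2])
  have := eq_mul_of_additive_of_nonneg (f := fun t => sepVol (c 0) (c (Real.pi * t)))
    (fun t _ _ => measureReal_nonneg)
    (fun s t hs ht hst => by
      simp only [mul_add]
      exact hadd _ _ (by positivity) (by positivity) (by nlinarith))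
    (t := θ / Real.pi) (div_nonneg (Real.arccos_nonneg _) hpi.le)
    ((div_le_one hpi).2 (Real.arccos_le_pi _))
  simp only [mul_div_cancel₀ _ hpi.ne', mul_one, hfull] at this
  rw [hxy, this]

/-- The averaged inequality obtained by rounding unit vectors to the signs of random linear forms:
the quadratic form of `A` at the matrix `(2/π) arcsin ⟨xᵢ, xⱼ⟩` is at most `‖A‖_θ`. -/
theorem sum_arcsin_le_thetaSeminorm {n : ℕ} (A : Matrix (Fin n) (Fin n) ℝ) {u w : E}
    (hu : ‖u‖ = 1) (hw : ‖w‖ = 1) (huw : inner ℝ u w = 0) (x : Fin n → E) (hx : ∀ i, ‖x i‖ = 1) :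
    ∑ i, ∑ j, A i j * phiReal (inner ℝ (x i) (x j)) ≤ thetaSeminorm A := by
  have hpi := Real.pi_pos
  set V := volume.real (ball (0 : E) 1) with hV
  have hVpos : 0 < V :=
    ENNReal.toReal_pos (measure_ball_pos volume _ one_pos).ne' measure_ball_lt_top.ne
  have hpt (g : E) (hg : g ∈ ball (0 : E) 1) :
      ∑ i, ∑ j, A i j * (1 - 2 * (separated (x i) (x j)).indicator (fun _ => (1 : ℝ)) g)
        ≤ thetaSeminorm A := by
    simp only [← signForm_mul_eq hg]
    refine (le_abs_self _).trans ((thetaSeminorm_isGreatest A).2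
      ⟨fun i => signForm (x i) g, fun i => ?_, ?_⟩)
    · by_cases h : 0 ≤ inner ℝ (x i) g <;> simp [signForm, h]
    · simp [Real.norm_eq_abs]
  have hint (i j : Fin n) : IntegrableOn
      (fun g => (separated (x i) (x j)).indicator (fun _ => (1 : ℝ)) g) (ball (0 : E) 1) volume :=
    (integrable_indicator_iff (measurableSet_separated _ _)).2
      (by
        refine integrableOn_const ?_
        exact ((Measure.restrict_apply_le _ _).trans_lt
          (separated_volume_ne_top (x i) (x j)).lt_top).ne)
  have hconst (a : ℝ) : IntegrableOn (fun _ : E => a) (ball (0 : E) 1) volume :=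
    integrableOn_const measure_ball_lt_top.ne
  have hval (i j : Fin n) : ∫ g in ball (0 : E) 1,
      A i j * (1 - 2 * (separated (x i) (x j)).indicator (fun _ => (1 : ℝ)) g) =
        V * (A i j * phiReal (inner ℝ (x i) (x j))) := by
    rw [integral_const_mul, integral_sub (hconst 1)
      ((hint i j).const_mul 2), integral_const_mul, setIntegral_const,
      integral_indicator (measurableSet_separated _ _), Measure.restrict_restrict
        (measurableSet_separated _ _), setIntegral_const,
      Set.inter_eq_left.2 (fun g (hg : g ∈ separated (x i) (x j)) => hg.1)]
    have := sepVol_eq_arccos hu hw huw (hx i) (hx j)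
    rw [sepVol] at this
    rw [this, phiReal, Real.arccos, ← hV]
    simp only [smul_eq_mul]
    field_simp
    ring
  have hI (i j : Fin n) : IntegrableOn (fun g => A i j *
      (1 - 2 * (separated (x i) (x j)).indicator (fun _ => (1 : ℝ)) g)) (ball (0 : E) 1) volume :=
    ((hconst 1).sub ((hint i j).const_mul 2)).const_mul _
  have hle : ∫ g in ball (0 : E) 1, ∑ i, ∑ j, A i j *
      (1 - 2 * (separated (x i) (x j)).indicator (fun _ => (1 : ℝ)) g)
        ≤ ∫ _ in ball (0 : E) 1, thetaSeminorm A :=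
    setIntegral_mono_on (integrable_finsetSum _ fun i _ => integrable_finsetSum _ fun j _ => hI i j)
      (hconst _) measurableSet_ball hpt
  rw [integral_finsetSum _ fun i _ => integrable_finsetSum _ fun j _ => hI i j] at hle
  simp only [integral_finsetSum _ fun j _ => hI _ j, hval, ← Finset.mul_sum, setIntegral_const,
    smul_eq_mul] at hle
  exact le_of_mul_le_mul_left hle hVpos

end Separation

/-! ### Numerical estimates for φ and the constants -/

section Estimates

/-- A Goemans–Williamson type estimate with the constant `33/40`. -/
theorem sub_le_phiReal_of_nonneg {t : ℝ} (h0 : 0 ≤ t) (h1 : t ≤ 1) :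
    33 / 40 * t - phiReal t ≤ 1 - 33 / 40 := by
  have hpi := Real.pi_pos
  have hpi3 := Real.pi_gt_d2
  have hpi4 := Real.pi_lt_d2
  set s := Real.arcsin t with hs
  have hs0 : 0 ≤ s := Real.arcsin_nonneg.2 h0
  have hs1 : s ≤ Real.pi / 2 := Real.arcsin_le_pi_div_two t
  have hst : Real.sin s = t := Real.sin_arcsin (by linarith) h1
  have hlin : t ≤ s := hst ▸ Real.sin_le hs0
  set z : ℝ := 2 / Real.pi * s with hz
  have hzs : s = Real.pi / 2 * z := by rw [hz]; field_simp
  have hz1 : z ≤ 1 := by rw [hz, div_mul_eq_mul_div, div_le_one hpi]; linarith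
  have hz0 : 0 ≤ z := by rw [hz]; positivity
  -- With t = sin(πz/2), this is cos v ≤ 1 - (2/π²)v² at v = (π/2)(1 - z).
  have hquad : t ≤ 1 - (1 - z) ^ 2 / 2 := by
    have h := Real.cos_le_one_sub_mul_cos_sq (x := Real.pi / 2 - s)
      (by rw [abs_of_nonneg (by linarith)]; linarith)
    rw [Real.cos_pi_div_two_sub, hst] at h
    refine h.trans_eq ?_
    rw [hzs]; field_simp
  change 33 / 40 * t - z ≤ _
  -- The linear bound t ≤ πz/2 suffices for z up to about 0.584 and the quadratic one from about
  -- 0.576; 0.58 lies in this narrow overlap.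
  rcases le_total z (0.58 : ℝ) with h | h
  · have : t ≤ 1.575 * z := by rw [hzs] at hlin; nlinarith
    nlinarith
  · nlinarith

theorem phiReal_le_self {t : ℝ} (h0 : 0 ≤ t) (h1 : t ≤ 1) : phiReal t ≤ t := by
  have h := Real.mul_le_sin (Real.arcsin_nonneg.2 h0) (Real.arcsin_le_pi_div_two t)
  rwa [Real.sin_arcsin (by linarith) h1] at h

theorem phiReal_nonneg {t : ℝ} (h0 : 0 ≤ t) : 0 ≤ phiReal t :=
  mul_nonneg (by positivity) (Real.arcsin_nonneg.2 h0)

theorem phiReal_neg (t : ℝ) : phiReal (-t) = -phiReal t := by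
  simp [phiReal, Real.arcsin_neg]

theorem phiReal_one : phiReal 1 = 1 := by
  rw [phiReal, Real.arcsin_one]; field_simp

theorem abs_phiReal_sub_le {t : ℝ} (ht : |t| ≤ 1) : |phiReal t - 33 / 40 * t| ≤ 1 - 33 / 40 := by
  have key {t : ℝ} (h0 : 0 ≤ t) (h1 : t ≤ 1) : |phiReal t - 33 / 40 * t| ≤ 1 - 33 / 40 := by
    rw [abs_le]
    have := phiReal_le_self h0 h1
    have := sub_le_phiReal_of_nonneg h0 h1
    constructor <;> linarith
  rcases le_total 0 t with h | h
  · exact key h (le_of_abs_le ht)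
  · have := key (t := -t) (by linarith) (by linarith [neg_abs_le t])
    rwa [phiReal_neg, mul_neg, neg_sub_neg, abs_sub_comm] at this

theorem alphaReal_mem : 0 < alphaReal ∧ alphaReal ≤ 1 := by
  -- This crude bound gives positivity and also the boundedness below needed to bound the infimum by
  -- its value 1 at x = 0.
  have hlow : ∀ r ∈ (fun x : ℝ => (1 + phiReal x) / (1 + x)) '' Set.Icc 0 1, 1 / 2 ≤ r := by
    rintro _ ⟨x, ⟨h0, h1⟩, rfl⟩
    have := phiReal_nonneg h0
    exact div_le_div₀ (by linarith) (by linarith) (by linarith) (by linarith)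
  refine ⟨lt_of_lt_of_le (by norm_num) (le_csInf ⟨_, 0, by simp, rfl⟩ hlow),
    csInf_le ⟨_, hlow⟩ ⟨0, by simp, by simp [phiReal]⟩⟩

theorem phiComplex_re_nonneg {x : ℝ} (h0 : 0 ≤ x) : 0 ≤ (phiComplex x).re := by
  have h : phiComplex x =
      ((Real.pi / 4 * ∑' k : ℕ, phiCoeff k * (x * |x| ^ (2 * k)) : ℝ) : ℂ) := by
    rw [phiComplex, Complex.norm_real, Real.norm_eq_abs]
    push_cast
    rfl
  rw [h, Complex.ofReal_re]
  exact mul_nonneg (by positivity)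
    (tsum_nonneg fun k => mul_nonneg (phiCoeff_nonneg k) (by positivity))

theorem alphaComplex_mem : 0 < alphaComplex ∧ alphaComplex ≤ 1 := by
  have hlow : ∀ r ∈ (fun x : ℝ => (1 + (phiComplex (x : ℂ)).re) / (1 + x)) '' Set.Icc 0 1,
      1 / 2 ≤ r := by
    rintro _ ⟨x, ⟨h0, h1⟩, rfl⟩
    have := phiComplex_re_nonneg h0
    exact div_le_div₀ (by linarith) (by linarith) (by linarith) (by linarith)
  refine ⟨lt_of_lt_of_le (by norm_num) (le_csInf ⟨_, 0, by simp, rfl⟩ hlow),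
    csInf_le ⟨_, hlow⟩ ⟨0, by simp, by simp [phiComplex]⟩⟩

/-- The threshold `63/80` is 3.15/4, so π < 3.15 covers a₀ = π/4. Then 1 + 17/80 = 97/80 just
exceeds 40/33, since 97·33 = 3201 and 80·40 = 3200. -/
theorem le_one_add_div {a α : ℝ} (ha : a ≤ 63 / 80) (hα0 : 0 < α) (hα1 : α ≤ 1) :
    40 / 33 ≤ 1 + (1 - a) / α := by
  have : 1 - a ≤ (1 - a) / α := le_div_self (by linarith) hα0 hα1
  linarith

end Estimates

/-! ### Diagonal dominance and the real inequality -/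

section DiagDominant

variable {n : ℕ} {A : Matrix (Fin n) (Fin n) ℝ}

/-- In each row the diagonal term c·aᵢᵢ absorbs the others, whose total modulus is at most c∑|aᵢⱼ|.
-/
theorem sum_mul_nonneg_of_diagDominant (hA : IsSymmDiagDominant A) {f : Fin n → Fin n → ℝ}
    {c : ℝ} (hd : ∀ i, f i i = c) (ho : ∀ i j, |f i j| ≤ c) : 0 ≤ ∑ i, ∑ j, A i j * f i j := by
  refine Finset.sum_nonneg fun i _ => ?_
  have hc : 0 ≤ c := (abs_nonneg _).trans (ho i i)
  rw [← Finset.add_sum_erase _ _ (Finset.mem_univ i), hd]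
  have h1 : -(∑ j ∈ Finset.univ.erase i, |A i j|) * c ≤
      ∑ j ∈ Finset.univ.erase i, A i j * f i j := by
    rw [neg_mul, Finset.sum_mul, ← Finset.sum_neg_distrib]
    refine Finset.sum_le_sum fun j _ => ?_
    refine le_trans ?_ (neg_abs_le _)
    rw [abs_mul]
    exact neg_le_neg (mul_le_mul_of_nonneg_left (ho i j) (abs_nonneg _))
  have h2 := mul_le_mul_of_nonneg_right (hA.2 i) hc
  linarith

theorem diag_nonneg (hA : IsSymmDiagDominant A) (i : Fin n) : 0 ≤ A i i :=
  (Finset.sum_nonneg fun _ _ => abs_nonneg _).trans (hA.2 i)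

theorem thetaSeminorm_nonneg {𝕜 : Type*} [RCLike 𝕜] (B : Matrix (Fin n) (Fin n) 𝕜) :
    0 ≤ thetaSeminorm B := by
  obtain ⟨δ, _, h⟩ := (thetaSeminorm_isGreatest B).1
  rw [h]; exact norm_nonneg _

variable {F : Type*} [NormedAddCommGroup F] [InnerProductSpace ℝ F]

/-- Bound ‖xᵢ‖‖xⱼ‖ by the mean of the squares. Symmetry collects the off-diagonal terms into row
sums times ‖xᵢ‖², which the diagonal dominates. -/
theorem sum_inner_self_nonneg (hA : IsSymmDiagDominant A) (x : Fin n → F) :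
    0 ≤ ∑ i, ∑ j, A i j * inner ℝ (x i) (x j) := by
  have hrow (i : Fin n) : 0 ≤ ∑ j, (A i j * inner ℝ (x i) (x j) +
      (if i = j then 0 else |A i j|) * ((‖x i‖ ^ 2 + ‖x j‖ ^ 2) / 2) -
      (if i = j then A i j * ‖x i‖ ^ 2 else 0)) := by
    refine Finset.sum_nonneg fun j _ => ?_
    split_ifs with h
    · subst h; rw [real_inner_self_eq_norm_sq]; simp
    · have h1 := abs_le.1 (abs_real_inner_le_norm (x i) (x j))
      have h2 : ‖x i‖ * ‖x j‖ ≤ (‖x i‖ ^ 2 + ‖x j‖ ^ 2) / 2 := by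
        nlinarith [sq_nonneg (‖x i‖ - ‖x j‖)]
      have h3 : |A i j * inner ℝ (x i) (x j)| ≤ |A i j| * ((‖x i‖ ^ 2 + ‖x j‖ ^ 2) / 2) := by
        rw [abs_mul]
        exact mul_le_mul_of_nonneg_left ((abs_real_inner_le_norm _ _).trans h2) (abs_nonneg _)
      linarith [neg_abs_le (A i j * inner ℝ (x i) (x j))]
  have hsum := Finset.sum_nonneg fun i (_ : i ∈ Finset.univ) => hrow i
  simp only [Finset.sum_sub_distrib, Finset.sum_add_distrib, Finset.sum_ite_eq,
    Finset.mem_univ, if_true] at hsum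
  have hoff (i : Fin n) : ∑ j, (if i = j then 0 else |A i j|) ≤ A i i := by
    refine le_trans (le_of_eq ?_) (hA.2 i)
    rw [← Finset.add_sum_erase _ _ (Finset.mem_univ i), if_pos rfl, zero_add]
    exact Finset.sum_congr rfl fun j hj => if_neg (Finset.ne_of_mem_erase hj).symm
  have hswap : ∑ i, ∑ j, (if i = j then 0 else |A i j|) * ((‖x i‖ ^ 2 + ‖x j‖ ^ 2) / 2) =
      ∑ i, (∑ j, (if i = j then 0 else |A i j|)) * ‖x i‖ ^ 2 := by
    have e1 : ∑ i, ∑ j, (if i = j then 0 else |A i j|) * ‖x j‖ ^ 2 =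
        ∑ i, ∑ j, (if i = j then 0 else |A i j|) * ‖x i‖ ^ 2 := by
      rw [Finset.sum_comm]
      refine Finset.sum_congr rfl fun i _ => Finset.sum_congr rfl fun j _ => ?_
      rw [hA.1.apply i j]
      simp only [eq_comm]
    have e2 : ∑ i, ∑ j, (if i = j then 0 else |A i j|) * ((‖x i‖ ^ 2 + ‖x j‖ ^ 2) / 2) =
        (∑ i, ∑ j, (if i = j then 0 else |A i j|) * ‖x i‖ ^ 2 +
          ∑ i, ∑ j, (if i = j then 0 else |A i j|) * ‖x j‖ ^ 2) / 2 := by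
      rw [← Finset.sum_add_distrib, Finset.sum_div]
      refine Finset.sum_congr rfl fun i _ => ?_
      rw [← Finset.sum_add_distrib, Finset.sum_div]
      exact Finset.sum_congr rfl fun j _ => by ring
    rw [e2, e1, add_self_div_two]
    exact Finset.sum_congr rfl fun i _ => (Finset.sum_mul _ _ _).symm
  have hle : ∑ i, (∑ j, (if i = j then 0 else |A i j|)) * ‖x i‖ ^ 2 ≤ ∑ i, A i i * ‖x i‖ ^ 2 :=
    Finset.sum_le_sum fun i _ => mul_le_mul_of_nonneg_right (hoff i) (by positivity)
  linarith

theorem sum_inner_le_of_norm_eq_one [FiniteDimensional ℝ F] (hA : IsSymmDiagDominant A)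
    {u w : F} (hu : ‖u‖ = 1) (hw : ‖w‖ = 1) (huw : inner ℝ u w = 0)
    {x : Fin n → F} (hx : ∀ i, ‖x i‖ = 1) :
    ∑ i, ∑ j, A i j * inner ℝ (x i) (x j) ≤ 40 / 33 * thetaSeminorm A := by
  borelize F
  have h1 := sum_arcsin_le_thetaSeminorm A hu hw huw x hx
  have h2 := sum_mul_nonneg_of_diagDominant hA (c := 1 - 33 / 40)
    (f := fun i j => phiReal (inner ℝ (x i) (x j)) - 33 / 40 * inner ℝ (x i) (x j))
    (fun i => by rw [real_inner_self_eq_norm_sq, hx]; norm_num [phiReal_one])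
    (fun i j => abs_phiReal_sub_le
      ((abs_real_inner_le_norm _ _).trans_eq (by rw [hx, hx, one_mul])))
  have h3 : ∑ i, ∑ j, A i j * (phiReal (inner ℝ (x i) (x j)) - 33 / 40 * inner ℝ (x i) (x j)) =
      ∑ i, ∑ j, A i j * phiReal (inner ℝ (x i) (x j)) -
        33 / 40 * ∑ i, ∑ j, A i j * inner ℝ (x i) (x j) := by
    simp only [mul_sub, Finset.sum_sub_distrib, Finset.mul_sum, mul_left_comm]
  rw [h3] at h2
  linarith

/-- The bound for vectors of norm at most one, which are completed to unit vectors in a larger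
space. -/
theorem sum_inner_self_le [FiniteDimensional ℝ F] (hA : IsSymmDiagDominant A)
    {x : Fin n → F} (hx : ∀ i, ‖x i‖ ≤ 1) :
    ∑ i, ∑ j, A i j * inner ℝ (x i) (x j) ≤ 40 / 33 * thetaSeminorm A := by
  let r (i : Fin n) : ℝ := √(1 - ‖x i‖ ^ 2)
  have hr (i : Fin n) : r i ^ 2 = 1 - ‖x i‖ ^ 2 :=
    Real.sq_sqrt (by nlinarith [hx i, norm_nonneg (x i)])
  -- The first n directions complete the xᵢ without changing inner products for i ≠ j. The last two
  -- supply the orthonormal pair for the arcsine law, whatever the dimension of `F`.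
  let b (k : Fin n ⊕ Fin 2) : EuclideanSpace ℝ (Fin n ⊕ Fin 2) := EuclideanSpace.single k 1
  have hb (k l) : inner ℝ (b k) (b l) = if k = l then 1 else 0 := by
    simp [b, EuclideanSpace.inner_single_left]
  let y (i : Fin n) : WithLp 2 (F × EuclideanSpace ℝ (Fin n ⊕ Fin 2)) :=
    WithLp.toLp 2 (x i, r i • b (Sum.inl i))
  let e (k : Fin 2) : WithLp 2 (F × EuclideanSpace ℝ (Fin n ⊕ Fin 2)) :=
    WithLp.toLp 2 (0, b (Sum.inr k))
  have hyy (i j : Fin n) : inner ℝ (y i) (y j) =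
      inner ℝ (x i) (x j) + if i = j then r i ^ 2 else 0 := by
    simp only [y, WithLp.prod_inner_apply, real_inner_smul_left, real_inner_smul_right, hb,
      Sum.inl.injEq]
    split_ifs with h
    · subst h; ring
    · ring
  have hee (k l) : inner ℝ (e k) (e l) = if k = l then 1 else 0 := by
    simp [e, WithLp.prod_inner_apply, hb]
  have norm_one {v : WithLp 2 (F × EuclideanSpace ℝ (Fin n ⊕ Fin 2))} (h : inner ℝ v v = 1) :
      ‖v‖ = 1 := by
    rw [real_inner_self_eq_norm_sq] at h
    exact (pow_eq_one_iff_of_nonneg (norm_nonneg _) two_ne_zero).1 h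
  have h := sum_inner_le_of_norm_eq_one hA (u := e 0) (w := e 1) (x := y)
    (norm_one ((hee 0 0).trans (if_pos rfl))) (norm_one ((hee 1 1).trans (if_pos rfl)))
    ((hee 0 1).trans (if_neg zero_ne_one))
    (fun i => norm_one (by rw [hyy, real_inner_self_eq_norm_sq, if_pos rfl, hr]; ring))
  refine le_trans (Finset.sum_le_sum fun i _ => Finset.sum_le_sum fun j _ => ?_) h
  rw [hyy, mul_add, le_add_iff_nonneg_right]
  split_ifs with hij
  · subst hij; exact mul_nonneg (diag_nonneg hA i) (sq_nonneg _)
  · simp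

/-- Positive semidefiniteness at x - y bounds twice the mixed form by the sum of the forms at x and
at y. -/
theorem sum_inner_le [FiniteDimensional ℝ F] (hA : IsSymmDiagDominant A) {x y : Fin n → F}
    (hx : ∀ i, ‖x i‖ ≤ 1) (hy : ∀ i, ‖y i‖ ≤ 1) :
    ∑ i, ∑ j, A i j * inner ℝ (x i) (y j) ≤ 40 / 33 * thetaSeminorm A := by
  have h0 := sum_inner_self_nonneg hA fun i => x i - y i
  have h1 := sum_inner_self_le hA hx
  have h2 := sum_inner_self_le hA hy
  have h3 : ∑ i, ∑ j, A i j * inner ℝ (y i) (x j) = ∑ i, ∑ j, A i j * inner ℝ (x i) (y j) := by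
    rw [Finset.sum_comm]
    refine Finset.sum_congr rfl fun i _ => Finset.sum_congr rfl fun j _ => ?_
    rw [hA.1.apply i j, real_inner_comm]
  simp only [inner_sub_left, inner_sub_right, mul_sub, Finset.sum_sub_distrib, h3] at h0
  linarith

end DiagDominant

/-! ### Passage to both scalar fields and to all the norms -/

section Fields

variable {𝕜 : Type*} [RCLike 𝕜] {n : ℕ} {A : Matrix (Fin n) (Fin n) ℝ}

theorem norm_sum_inner_le {E : Type*} [NormedAddCommGroup E] [InnerProductSpace 𝕜 E]
    [FiniteDimensional 𝕜 E] (hA : IsSymmDiagDominant A) {x y : Fin n → E} (hx : ∀ i, ‖x i‖ ≤ 1) (hy : ∀ i, ‖y i‖ ≤ 1) :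
    ‖∑ i, ∑ j, (A i j : 𝕜) * inner 𝕜 (x i) (y j)‖ ≤ 40 / 33 * thetaSeminorm A := by
  let _ : InnerProductSpace ℝ E := InnerProductSpace.rclikeToReal 𝕜 E
  have : IsScalarTower ℝ 𝕜 E := ⟨fun a c v => by
    rw [Algebra.smul_def, mul_smul]; rfl⟩
  have : FiniteDimensional ℝ E := FiniteDimensional.trans ℝ 𝕜 E
  set S := ∑ i, ∑ j, (A i j : 𝕜) * inner 𝕜 (x i) (y j) with hS
  -- Multiplying every yⱼ by this phase makes the sum equal to its modulus. As A is real, only real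
  -- parts of inner products then enter.
  obtain ⟨c, hc, hcS⟩ : ∃ c : 𝕜, ‖c‖ = 1 ∧ c * S = ‖S‖ := by
    obtain ⟨c, hc, h⟩ := RCLike.exists_norm_eq_mul_self S
    exact ⟨c, hc, h.symm⟩
  have h := sum_inner_le hA (y := fun j => c • y j) hx
    (fun j => by rw [norm_smul, hc, one_mul]; exact hy j)
  refine le_trans (le_of_eq ?_) h
  have h2 : ‖S‖ = RCLike.re (c * S) := by rw [hcS, RCLike.ofReal_re]
  rw [h2, hS, Finset.mul_sum, map_sum]
  refine Finset.sum_congr rfl fun i _ => ?_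
  rw [Finset.mul_sum, map_sum]
  refine Finset.sum_congr rfl fun j _ => ?_
  rw [real_inner_eq_re_inner 𝕜, inner_smul_right, mul_left_comm, RCLike.re_ofReal_mul]

theorem thetaSeminorm_le_map (A : Matrix (Fin n) (Fin n) ℝ) :
    thetaSeminorm A ≤ thetaSeminorm (A.map (RCLike.ofReal : ℝ → 𝕜)) := by
  obtain ⟨δ, hδ, h⟩ := (thetaSeminorm_isGreatest A).1
  refine (thetaSeminorm_isGreatest _).2 ⟨fun i => (δ i : 𝕜), fun i => ?_, ?_⟩
  · rw [RCLike.norm_ofReal, ← Real.norm_eq_abs, hδ]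
  · rw [h, Real.norm_eq_abs, ← RCLike.norm_ofReal (K := 𝕜)]
    simp

theorem thetaSeminorm_le_of_mem (B : Matrix (Fin n) (Fin n) 𝕜) {M : ℝ}
    (hM : M ∈ ({thetaSeminorm B, capThetaNorm B, inftyOneNorm B} : Set ℝ)) :
    thetaSeminorm B ≤ M := by
  obtain ⟨δ, hδ, h⟩ := (thetaSeminorm_isGreatest B).1
  rcases hM with rfl | rfl | rfl
  · exact le_rfl
  · exact (capThetaNorm_isGreatest B).2 ⟨δ, fun i => (hδ i).le, h⟩
  · exact (inftyOneNorm_isGreatest B).2 ⟨δ, δ, fun i => (hδ i).le, fun i => (hδ i).le, h⟩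

theorem le_mul_thetaSeminorm_of_mem (hA : IsSymmDiagDominant A) {d e : ℕ} (hd : n ≤ d) {N : ℝ}
    (hN : N ∈ ({gammaSeminorm d (A.map (RCLike.ofReal : ℝ → 𝕜)),
      capGammaNorm d (A.map (RCLike.ofReal : ℝ → 𝕜)),
      gNorm e (A.map (RCLike.ofReal : ℝ → 𝕜))} : Set ℝ)) :
    N ≤ 40 / 33 * thetaSeminorm A := by
  rcases hN with rfl | rfl | rfl
  · obtain ⟨x, hx, h⟩ := (gammaSeminorm_isGreatest hd (A.map (RCLike.ofReal : ℝ → 𝕜))).1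
    rw [h]; exact norm_sum_inner_le hA (fun i => (hx i).le) fun i => (hx i).le
  · obtain ⟨x, hx, h⟩ := (capGammaNorm_isGreatest d (A.map (RCLike.ofReal : ℝ → 𝕜))).1
    rw [h]; exact norm_sum_inner_le hA hx hx
  · obtain ⟨x, y, hx, hy, h⟩ := (gNorm_isGreatest e (A.map (RCLike.ofReal : ℝ → 𝕜))).1
    rw [h]; exact norm_sum_inner_le hA hx hy

/-- The comparison of the two families of norms, for any constant that is at least `40/33`. -/
theorem le_mul_of_mem (hA : IsSymmDiagDominant A) {d e : ℕ} (hd : n ≤ d) {C : ℝ}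
    (hC : 40 / 33 ≤ C) {N M : ℝ}
    (hN : N ∈ ({gammaSeminorm d (A.map (RCLike.ofReal : ℝ → 𝕜)),
      capGammaNorm d (A.map (RCLike.ofReal : ℝ → 𝕜)),
      gNorm e (A.map (RCLike.ofReal : ℝ → 𝕜))} : Set ℝ))
    (hM : M ∈ ({thetaSeminorm (A.map (RCLike.ofReal : ℝ → 𝕜)),
      capThetaNorm (A.map (RCLike.ofReal : ℝ → 𝕜)),
      inftyOneNorm (A.map (RCLike.ofReal : ℝ → 𝕜))} : Set ℝ)) :
    N ≤ C * M :=
  (le_mul_thetaSeminorm_of_mem hA hd hN).trans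
    (mul_le_mul hC ((thetaSeminorm_le_map A).trans (thetaSeminorm_le_of_mem _ hM))
      (thetaSeminorm_nonneg A) (by linarith))

end Fields

end Groth

theorem proposition5p4 (n d e : ℕ) (hd : n ≤ d) (he : n + n ≤ e)
    (A : Matrix (Fin n) (Fin n) ℝ) (hA : Groth.IsSymmDiagDominant A) :
    -- over the real field
    (∀ N ∈ ({Groth.gammaSeminorm d A, Groth.capGammaNorm d A, Groth.gNorm e A} : Set ℝ),
      ∀ M ∈ ({Groth.thetaSeminorm A, Groth.capThetaNorm A, Groth.inftyOneNorm A} : Set ℝ),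
        N ≤ (1 + (1 - 2 / Real.pi) / Groth.alphaReal) * M) ∧
    -- over the complex field, with the same real matrix regarded as a complex one
    (∀ N ∈ ({Groth.gammaSeminorm d (A.map Complex.ofReal),
        Groth.capGammaNorm d (A.map Complex.ofReal),
        Groth.gNorm e (A.map Complex.ofReal)} : Set ℝ),
      ∀ M ∈ ({Groth.thetaSeminorm (A.map Complex.ofReal),
          Groth.capThetaNorm (A.map Complex.ofReal),
          Groth.inftyOneNorm (A.map Complex.ofReal)} : Set ℝ),
        N ≤ (1 + (1 - Real.pi / 4) / Groth.alphaComplex) * M) := by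
  have hpi3 := Real.pi_gt_d2
  have hpi4 := Real.pi_lt_d2
  refine ⟨fun N hN M hM => ?_, fun N hN M hM => ?_⟩
  · have hmap : A.map (RCLike.ofReal : ℝ → ℝ) = A := by ext i j; simp
    refine Groth.le_mul_of_mem (𝕜 := ℝ) hA hd (Groth.le_one_add_div ?_ Groth.alphaReal_mem.1
      Groth.alphaReal_mem.2) (by rwa [hmap]) (by rwa [hmap])
    rw [div_le_div_iff₀ Real.pi_pos (by norm_num)]; linarith
  · exact Groth.le_mul_of_mem (𝕜 := ℂ) hA hd (Groth.le_one_add_div (by linarith)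
      Groth.alphaComplex_mem.1 Groth.alphaComplex_mem.2) hN hM
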